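/- **Definitions.** Let $\Sigma$ be a finite alphabet and $k\ge 1$. A *deterministic one-way $k$-head finite automaton* over $\Sigma$ consists of a finite set $Q$ of states, an end-marker $\lhd\notin\Sigma$, an initial state $q_0\in Q$, a set $Q_a\subseteq Q$ of accepting states and a transition function $\delta:Q\times(\Sigma\cup\{\lhd\})^k\to Q\times\{0,1\}^k$ such that $\delta(q,a_1,\dots,a_k)=(q',m_1,\dots,m_k)$ and $a_i=\lhd$ imply $m_i=0$. On a word $w$ of length $n$, the letters of $w$ are at positions $0,\dots,n-1$ and $\lhd$ is at position $n$. The computation starts at time $0$ in state $q_0$ with all $k$ heads at position $0$; at each step $\delta$ is applied to the current state and the $k$ symbols read, giving the new state, and head $i$ advances by $m_i$. The computation ends at the first time when all heads are at position $n$, and $w$ is accepted iff the computation ends and the state at that time is in $Q_a$. The language recognised by the automaton is the set of accepted words. The automaton is *oblivious* (data-independent) if there is $f:\mathbb N^2\to\mathbb N^k$ such that, for every word $w$ and every time $t$, the positions of the $k$ heads at time $t$ on input $w$ are $f(|w|,t)$; it is then called a $1\mathrm{DIDFA}(k)$. A *cellular automaton* (CA) with input alphabet $\Sigma$ consists of a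 finite set of states $Q'\supset\Sigma$, a quiescent state $\#\in Q'\setminus\Sigma$, a set $Q'_a\subseteq Q'$ of accepting states and a map $\delta':Q'^3\to Q'$ with $\delta'(\#,\#,\#)=\#$. On a word $w$ of length $n$, at time $0$ the cells $0,\dots,n-1$ of $\mathbb Z$ contain the letters of $w$ and all other cells are in state $\#$; the states $\langle c,t\rangle$ of cell $c$ at time $t$ satisfy $\langle c,t+1\rangle=\delta'(\langle c-1,t\rangle,\langle c,t\rangle,\langle c+1,t\rangle)$. The CA recognises a language $\mathcal L\subseteq\Sigma^*$ *in real time* if, for every word $w\in\Sigma^*$ of length $n$, $w\in\mathcal L$ if and only if $\langle 0,n\rangle\in Q'_a$ in the computation on $w$. (For the empty word this means that the empty word is in $\mathcal L$ if and only if $\#\in Q'_a$.) **Theorem.** Let $k\ge 1$. For every oblivious deterministic one-way $k$-head finite automaton, that is, every $1\mathrm{DIDFA}(k)$, recognising a language $\mathcal L$, there exists a cellular automaton recognising $\mathcal L$ in real time. -/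

import Mathlib

universe u v

/-- A deterministic one-way `k`-head finite automaton over the alphabet `α`. The tape alphabet
`Σ ∪ {⊲}` is `Option α`, with `none` as the right end-marker. In the transition function, the
Boolean `true` moves a head one letter to the right and `false` keeps it in place; a head that
reads the end-marker may not move. -/
structure OneWayMultiheadDFA (α : Type u) (k : ℕ) where
  State : Type v
  finite_state : Finite State
  start : State
  accept : Set State
  step : State → (Fin k → Option α) → State × (Fin k → Bool)
  step_endMarker : ∀ (q : State) (a : Fin k → Option α) (i : Fin k),
    a i = none → (step q a).2 i = false

namespace OneWayMultiheadDFA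

variable {α : Type u} {k : ℕ}

/-- The configuration (head positions, state) at time `t` on the input `w`. All heads start at
position `0`. The letter at position `p` is `w[p]?`, which is the end-marker `none` exactly when
`p` is at least the length of `w`. -/
def config (F : OneWayMultiheadDFA.{u, v} α k) (w : List α) : ℕ → (Fin k → ℕ) × F.State
  | 0 => (fun _ => 0, F.start)
  | t + 1 =>
    let p := (F.config w t).1
    let r := F.step (F.config w t).2 (fun i => w[p i]?)
    (fun i => if r.2 i = true then p i + 1 else p i, r.1)

/-- At time `t` all heads are on the end-marker. -/
def AllAtEnd (F : OneWayMultiheadDFA.{u, v} α k) (w : List α) (t : ℕ) : Prop :=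
  ∀ i : Fin k, (F.config w t).1 i = w.length

/-- The computation ends at time `t`: this is the first time at which all heads are on the
end-marker. -/
def HaltsAt (F : OneWayMultiheadDFA.{u, v} α k) (w : List α) (t : ℕ) : Prop :=
  F.AllAtEnd w t ∧ ∀ s < t, ¬ F.AllAtEnd w s

/-- The language recognised by the automaton: the words on which the computation ends, in an
accepting state. -/
def language (F : OneWayMultiheadDFA.{u, v} α k) : Language α :=
  {w | ∃ t, F.HaltsAt w t ∧ (F.config w t).2 ∈ F.accept}

/-- Obliviousness (data-independence): the positions of the heads at time `t` are a function of
the length of the input and of `t` only. -/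
def IsOblivious (F : OneWayMultiheadDFA.{u, v} α k) : Prop :=
  ∃ f : ℕ → ℕ → (Fin k → ℕ), ∀ (w : List α) (t : ℕ), (F.config w t).1 = f w.length t

end OneWayMultiheadDFA

/-- A one-dimensional cellular automaton with the neighbourhood of radius `1` and with input
alphabet `α`. The inclusion of the alphabet in the set of states is the injection `letter`. -/
structure CellularAutomaton (α : Type u) where
  State : Type
  finite_state : Finite State
  letter : α ↪ State
  quiescent : State
  quiescent_not_letter : ∀ a : α, letter a ≠ quiescent
  accept : Set State
  step : State → State → State → State
  step_quiescent : step quiescent quiescent quiescent = quiescent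

namespace CellularAutomaton

variable {α : Type u}

/-- The initial configuration: the letters of `w` on the cells `0, …, n - 1`, where `n` is the
length of `w`, and the quiescent state on all other cells. -/
def initial (C : CellularAutomaton α) (w : List α) : ℤ → C.State
  | Int.ofNat c => (w[c]?).elim C.quiescent C.letter
  | Int.negSucc _ => C.quiescent

/-- The configuration at time `t` on the input `w`. -/
def config (C : CellularAutomaton α) (w : List α) : ℕ → ℤ → C.State
  | 0 => C.initial w
  | t + 1 => fun c =>
    C.step (C.config w t (c - 1)) (C.config w t c) (C.config w t (c + 1))

/-- The language recognised in time `τ`: the words `w` for which the cell `0` is in an accepting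
state at time exactly `τ n`, where `n` is the length of `w`. -/
def languageInTime (C : CellularAutomaton α) (τ : ℕ → ℕ) : Language α :=
  {w | C.config w (τ w.length) 0 ∈ C.accept}

/-- The language recognised in real time. -/
def realTimeLanguage (C : CellularAutomaton α) : Language α :=
  C.languageInTime id

end CellularAutomaton

/-! By obliviousness, the heads move on every word of length `n` as they do on `a ^ n`. There the
symbols read change only when a head reaches the end-marker, so in between the run becomes periodic.
After splitting the lengths into finitely many progressions `N m + ρ`, a halting run is a bounded
number of phases; a phase ends with the heads at affine positions `A i m + B i` and either has
bounded duration or repeats a fixed block of steps `m` times.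

On a general word the letters affect the states, not the positions. A long phase is thus a product
of `m` maps of the finite state set, the `c`-th one given by letters at positions `A m + D c + B`
with `A + D ≤ N`. A CA brings these letters to the cell `c` on the diagonal `c + t = N m`
(`exists_letter_field`) and composes the maps along the diagonal towards the cell `0`
(`exists_composition_field`), which is reached at time `N m`. Since maps and not states are
computed, all phases are processed in parallel and applied one after another only at the cell `0`;
this is why real time suffices for a longer run.

`Reaches.decided` carries out the induction on phases; `exists_caRun_of_slide` and
`exists_cellularAutomaton` convert the resulting field into an actual CA. -/

/-! ### Space-time fields computed by cellular automata, and their closure properties. -/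

/-- The tape of the word `w`: its letters on the cells `0, …, n - 1` and `none` elsewhere. -/
def tape {α : Type u} (w : List α) : ℤ → Option α
  | Int.ofNat c => w[c]?
  | Int.negSucc _ => none

@[simp] theorem tape_natCast {α : Type u} (w : List α) (c : ℕ) : tape w (c : ℤ) = w[c]? := rfl

theorem tape_of_neg {α : Type u} (w : List α) {c : ℤ} (hc : c < 0) : tape w c = none := by
  cases c with
  | ofNat c => exact absurd hc (by simp)
  | negSucc c => rfl

/-- The run of the radius-one rule `δ` from the configuration `x`. -/
def caRun {S : Type*} (δ : S → S → S → S) (x : ℤ → S) : ℕ → ℤ → S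
  | 0 => x
  | t + 1 => fun c => δ (caRun δ x t (c - 1)) (caRun δ x t c) (caRun δ x t (c + 1))

theorem caRun_zero {S : Type*} (δ : S → S → S → S) (x : ℤ → S) : caRun δ x 0 = x := rfl

theorem caRun_succ {S : Type*} (δ : S → S → S → S) (x : ℤ → S) (t : ℕ) (c : ℤ) :
    caRun δ x (t + 1) c =
      δ (caRun δ x t (c - 1)) (caRun δ x t c) (caRun δ x t (c + 1)) := rfl

/-- `ι` depends only on the cells at distance at most `R` from the origin. -/
def IsLocal {β S : Type*} (R : ℕ) (ι : (ℤ → β) → S) : Prop :=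
  ∀ x y : ℤ → β, (∀ i : ℤ, |i| ≤ R → x i = y i) → ι x = ι y

theorem IsLocal.mono {β S : Type*} {R R' : ℕ} {ι : (ℤ → β) → S} (h : IsLocal R ι) (hR : R ≤ R') :
    IsLocal R' ι :=
  fun x y hxy => h x y fun i hi => hxy i (hi.trans (by exact_mod_cast hR))

/-- The configuration obtained by applying `ι` to the window around each cell. -/
def slide {β S : Type*} (ι : (ℤ → β) → S) (x : ℤ → β) : ℤ → S :=
  fun c => ι fun i => x (c + i)

/-- A space-time field `φ w c t` is a CA field if it can be read off, on every nonempty word `w`,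
from the run of a finite radius-one rule whose initial configuration is a sliding block code of
the tape. -/
def IsCAField {α : Type u} {T : Type*} (φ : List α → ℤ → ℕ → T) : Prop :=
  ∃ (S : Type) (_ : Finite S) (R : ℕ) (ι : (ℤ → Option α) → S) (δ : S → S → S → S) (out : S → T),
    IsLocal R ι ∧ ∀ w : List α, w ≠ [] → ∀ c t, φ w c t = out (caRun δ (slide ι (tape w)) t c)

namespace IsCAField

variable {α : Type u} {T : Type*} {U : Type*}

theorem congr {φ ψ : List α → ℤ → ℕ → T} (hφ : IsCAField φ)
    (h : ∀ w, w ≠ [] → ∀ c t, ψ w c t = φ w c t) : IsCAField ψ := by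
  obtain ⟨S, hS, R, ι, δ, out, hι, hrun⟩ := hφ
  exact ⟨S, hS, R, ι, δ, out, hι, fun w hw c t => (h w hw c t).trans (hrun w hw c t)⟩

theorem comp {φ : List α → ℤ → ℕ → T} (hφ : IsCAField φ) (f : T → U) :
    IsCAField fun w c t => f (φ w c t) := by
  obtain ⟨S, hS, R, ι, δ, out, hι, hrun⟩ := hφ
  exact ⟨S, hS, R, ι, δ, f ∘ out, hι, fun w hw c t => by simp [hrun w hw c t]⟩

/-- Recursion in time along a given CA field. -/
theorem recursion [Finite T] {ψ : List α → ℤ → ℕ → U} (hψ : IsCAField ψ) (i : U → T)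
    (G : T → T → T → U → U → T) {φ : List α → ℤ → ℕ → T}
    (h0 : ∀ w, w ≠ [] → ∀ c, φ w c 0 = i (ψ w c 0))
    (hs : ∀ w, w ≠ [] → ∀ c t, φ w c (t + 1) =
      G (φ w (c - 1) t) (φ w c t) (φ w (c + 1) t) (ψ w c t) (ψ w c (t + 1))) :
    IsCAField φ := by
  obtain ⟨S, hS, R, ι, δ, out, hι, hrun⟩ := hψ
  -- `T` may live in any universe, while the states of the rule must form a `Type`.
  obtain ⟨n, ⟨e⟩⟩ := Finite.exists_equiv_fin T
  let δ' : S × Fin n → S × Fin n → S × Fin n → S × Fin n := fun l m r =>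
    (δ l.1 m.1 r.1,
      e (G (e.symm l.2) (e.symm m.2) (e.symm r.2) (out m.1) (out (δ l.1 m.1 r.1))))
  have key : ∀ w : List α, w ≠ [] → ∀ t c,
      caRun δ' (slide (fun x => (ι x, e (i (out (ι x))))) (tape w)) t c =
        (caRun δ (slide ι (tape w)) t c, e (φ w c t)) := by
    intro w hw t
    induction t with
    | zero =>
      intro c
      rw [h0 w hw, hrun w hw]
      rfl
    | succ t ih =>
      intro c
      rw [caRun_succ, ih, ih, ih, hs w hw, hrun w hw, hrun w hw, caRun_succ]
      simp [δ']
  refine ⟨S × Fin n, inferInstance, R, fun x => (ι x, e (i (out (ι x)))), δ',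
    fun s => e.symm s.2, ?_, ?_⟩
  · intro x y hxy
    simp only [hι x y hxy]
  · intro w hw c t
    rw [key w hw]
    simp

theorem exists_recursion [Finite T] {ψ : List α → ℤ → ℕ → U} (hψ : IsCAField ψ) (i : U → T)
    (G : T → T → T → U → U → T) :
    ∃ φ : List α → ℤ → ℕ → T, IsCAField φ ∧ (∀ w c, φ w c 0 = i (ψ w c 0)) ∧
      ∀ w c t, φ w c (t + 1) =
        G (φ w (c - 1) t) (φ w c t) (φ w (c + 1) t) (ψ w c t) (ψ w c (t + 1)) := by
  let φ' : List α → ℕ → ℤ → T := fun w t => Nat.rec (fun c => i (ψ w c 0))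
    (fun t f c => G (f (c - 1)) (f c) (f (c + 1)) (ψ w c t) (ψ w c (t + 1))) t
  refine ⟨fun w c t => φ' w t c, recursion hψ i G ?_ ?_, ?_, ?_⟩ <;> intros <;> rfl

theorem of_isLocal [Finite T] {R : ℕ} {ι : (ℤ → Option α) → T} (hι : IsLocal R ι) :
    IsCAField fun w c (_ : ℕ) => slide ι (tape w) c := by
  obtain ⟨n, ⟨e⟩⟩ := Finite.exists_equiv_fin T
  refine ⟨Fin n, inferInstance, R, fun x => e (ι x), fun _ m _ => m, e.symm, ?_, ?_⟩
  · intro x y hxy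
    simp only [hι x y hxy]
  · intro w _ c t
    induction t with
    | zero => simp [caRun_zero, slide]
    | succ t ih => rw [caRun_succ, ← ih]

theorem const (a : T) : IsCAField fun (_ : List α) (_ : ℤ) (_ : ℕ) => a :=
  (of_isLocal (R := 0) (ι := fun _ : ℤ → Option α => ()) fun _ _ _ => rfl).comp fun _ => a

theorem pi {J : Type} [Finite J] {T : J → Type*} {φ : ∀ j, List α → ℤ → ℕ → T j}
    (hφ : ∀ j, IsCAField (φ j)) : IsCAField fun w c t j => φ j w c t := by
  choose S hS R ι δ out hι hrun using hφ
  obtain ⟨M, hM⟩ := (Set.finite_range R).bddAbove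
  have key : ∀ w t c,
      caRun (fun l m r j => δ j (l j) (m j) (r j)) (slide (fun x j => ι j x) (tape w)) t c =
        fun j => caRun (δ j) (slide (ι j) (tape w)) t c := by
    intro w t
    induction t with
    | zero => intro c; rfl
    | succ t ih => intro c; rw [caRun_succ, ih, ih, ih]; rfl
  refine ⟨∀ j, S j, inferInstance, M, fun x j => ι j x, fun l m r j => δ j (l j) (m j) (r j),
    fun s j => out j (s j), ?_, ?_⟩
  · intro x y hxy
    funext j
    exact (hι j).mono (hM ⟨j, rfl⟩) x y hxy
  · intro w hw c t
    rw [key]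
    funext j
    exact hrun j w hw c t

theorem prod {φ : List α → ℤ → ℕ → T} {ψ : List α → ℤ → ℕ → U} (hφ : IsCAField φ)
    (hψ : IsCAField ψ) : IsCAField fun w c t => (φ w c t, ψ w c t) := by
  obtain ⟨S, hS, R, ι, δ, out, hι, hrun⟩ := hφ
  obtain ⟨S', hS', R', ι', δ', out', hι', hrun'⟩ := hψ
  have key : ∀ w t c,
      caRun (fun l m r : S × S' => (δ l.1 m.1 r.1, δ' l.2 m.2 r.2))
          (slide (fun x => (ι x, ι' x)) (tape w)) t c =
        (caRun δ (slide ι (tape w)) t c, caRun δ' (slide ι' (tape w)) t c) := by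
    intro w t
    induction t with
    | zero => intro c; rfl
    | succ t ih => intro c; rw [caRun_succ, ih, ih, ih]; rfl
  refine ⟨S × S', inferInstance, max R R', fun x => (ι x, ι' x),
    fun l m r => (δ l.1 m.1 r.1, δ' l.2 m.2 r.2), fun s => (out s.1, out' s.2), ?_, ?_⟩
  · intro x y hxy
    simp only [hι.mono (le_max_left _ _) x y hxy, hι'.mono (le_max_right _ _) x y hxy]
  · intro w hw c t
    simp only [key, hrun w hw, hrun' w hw]

theorem map₂ {V : Type*} {φ : List α → ℤ → ℕ → T} {ψ : List α → ℤ → ℕ → U} (hφ : IsCAField φ)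
    (hψ : IsCAField ψ) (f : T → U → V) : IsCAField fun w c t => f (φ w c t) (ψ w c t) :=
  (hφ.prod hψ).comp fun p => f p.1 p.2

/-- Truncated subtraction makes the delayed field repeat its initial value once. -/
theorem delay_one {φ : List α → ℤ → ℕ → T} (hφ : IsCAField φ) :
    IsCAField fun w c t => φ w c (t - 1) := by
  obtain ⟨S, hS, R, ι, δ, out, hι, hrun⟩ := hφ
  have hs : IsCAField fun (w : List α) c t => caRun δ (slide ι (tape w)) t c :=
    ⟨S, hS, R, ι, δ, id, hι, fun _ _ _ _ => rfl⟩
  have hd : IsCAField fun (w : List α) c t => caRun δ (slide ι (tape w)) (t - 1) c :=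
    hs.recursion id (fun _ _ _ p _ => p) (fun _ _ _ => rfl) (fun _ _ _ _ => rfl)
  exact (hd.comp out).congr fun w hw c t => hrun w hw c (t - 1)

theorem delay {φ : List α → ℤ → ℕ → T} (hφ : IsCAField φ) (d : ℕ) :
    IsCAField fun w c t => φ w c (t - d) := by
  induction d with
  | zero => simpa using hφ
  | succ d ih =>
    refine ih.delay_one.congr fun w _ c t => ?_
    rw [Nat.sub_sub, Nat.add_comm 1 d]

theorem of_periodic {P : ℕ} (hP : 0 < P) {g : ℕ → T} (hg : Function.Periodic g P) :
    IsCAField fun (_ : List α) (_ : ℤ) t => g t := by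
  have : NeZero P := ⟨hP.ne'⟩
  have h : IsCAField fun (_ : List α) (_ : ℤ) t => ((t : ℕ) : ZMod P) :=
    (const ()).recursion (fun _ => 0) (fun _ m _ _ _ => m + 1) (by simp) (by simp)
  refine (h.comp fun z => g z.val).congr fun w _ c t => ?_
  rw [ZMod.val_natCast, hg.map_mod_nat]

theorem time_eq (n : ℕ) : IsCAField fun (_ : List α) (_ : ℤ) t => t = n := by
  induction n with
  | zero =>
    exact (const ()).recursion (fun _ => True) (fun _ _ _ _ _ => False) (by simp) (by simp)
  | succ n ih => exact ih.recursion (fun _ => False) (fun _ _ _ p _ => p) (by simp) (by simp)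

theorem tape_shift [Finite α] (b : ℤ) : IsCAField fun (w : List α) c (_ : ℕ) => tape w (c + b) :=
  of_isLocal (R := b.natAbs) (ι := fun x : ℤ → Option α => x b) fun _ _ h => h b (by simp)

end IsCAField

/-! ### Removal of the initial block code without loss of time. -/

theorem caRun_congr {S : Type*} (δ : S → S → S → S) {x y : ℤ → S} (t : ℕ) :
    ∀ c : ℤ, (∀ i, |i - c| ≤ t → x i = y i) → caRun δ x t c = caRun δ y t c := by
  induction t with
  | zero => exact fun c h => h c (by simp)
  | succ t ih =>
    intro c h
    rw [caRun_succ, caRun_succ, ih, ih, ih]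
    all_goals
      intro i hi
      apply h
      rw [abs_le] at hi ⊢
      push_cast
      omega

theorem caRun_slide_congr {β S : Type*} {δ : S → S → S → S} {R : ℕ} {ι : (ℤ → β) → S}
    (hι : IsLocal R ι) {x y : ℤ → β} (t : ℕ) (c : ℤ) (h : ∀ i, |i - c| ≤ t + R → x i = y i) :
    caRun δ (slide ι x) t c = caRun δ (slide ι y) t c := by
  refine caRun_congr δ t c fun i hi => hι _ _ fun j hj => h _ ?_
  rw [abs_le] at *
  omega

/-- The tape `x` seen from the cell `c` at time `t`, completed by `p.1` on its left and by `p.2` on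
its right; the lists are read away from `c`. -/
def patch {β : Type*} (x : ℤ → Option β) (c : ℤ) (t : ℕ) (p : (ℕ → Option β) × (ℕ → Option β)) :
    ℤ → Option β := fun i =>
  if i < c - t then p.1 (c - t - 1 - i).toNat
  else if c + t < i then p.2 (i - c - t - 1).toNat else x i

/-- A finite sequence continued by `none`. -/
def padNone {β : Type*} {R : ℕ} (f : Fin R → Option β) (j : ℕ) : Option β :=
  if h : j < R then f ⟨j, h⟩ else none

/-- The sequence `a, f 0, f 1, …`. -/
def consSeq {β : Type*} (a : β) (f : ℕ → β) : ℕ → β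
  | 0 => a
  | j + 1 => f j

theorem patch_center {β : Type*} (x : ℤ → Option β) (c : ℤ)
    (p : (ℕ → Option β) × (ℕ → Option β)) (j : ℤ) :
    patch (fun _ => x c) 0 0 p j = patch x c 0 p (c + j) := by
  simp only [patch, Nat.cast_zero, sub_zero, add_zero]
  rcases lt_trichotomy j 0 with h | h | h
  · rw [if_pos h, if_pos (show c + j < c by omega)]
    exact congrArg p.1 (by omega)
  · simp [h]
  · rw [if_neg (show ¬j < 0 by omega), if_pos h, if_neg (show ¬c + j < c by omega),
      if_pos (show c < c + j by omega)]
    exact congrArg p.2 (by omega)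

theorem patch_of_lt {β : Type*} {x : ℤ → Option β} {c z : ℤ} {t : ℕ} (f g : ℕ → Option β) {j : ℕ}
    (h : z = c - t - 1 - j) : patch x c t (f, g) z = f j := by
  subst h
  rw [patch, if_pos (by omega)]
  exact congrArg f (by omega)

theorem patch_of_gt {β : Type*} {x : ℤ → Option β} {c z : ℤ} {t : ℕ} (f g : ℕ → Option β) {j : ℕ}
    (h : z = c + t + 1 + j) : patch x c t (f, g) z = g j := by
  subst h
  rw [patch, if_neg (by omega), if_pos (by omega)]
  exact congrArg g (by omega)

theorem patch_of_mem {β : Type*} {x : ℤ → Option β} {c z : ℤ} {t : ℕ} (f g : ℕ → Option β)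
    (h : c - t ≤ z) (h' : z ≤ c + t) : patch x c t (f, g) z = x z := by
  rw [patch, if_neg (by omega), if_neg (by omega)]

/-- At time `t` the cell `c - 1` has not yet seen the last two letters of the window of `c` at time
`t + 1`; they become the start of its right-hand guess. `patch_self` and `patch_add_one` treat the
other two neighbours. -/
theorem patch_sub_one {β : Type*} (x : ℤ → Option β) (c : ℤ) (t : ℕ) (f g : ℕ → Option β) :
    patch x (c - 1) t (f, consSeq (x (c + t)) (consSeq (x (c + 1 + t)) g)) =
      patch x c (t + 1) (f, g) := by
  funext z
  by_cases h1 : z < c - 1 - t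
  · obtain ⟨j, hj⟩ : ∃ j : ℕ, z = c - 1 - t - 1 - j := ⟨(c - 1 - t - 1 - z).toNat, by omega⟩
    rw [patch_of_lt _ _ hj, patch_of_lt f g (j := j) (by omega)]
  by_cases h2 : c - 1 + t < z
  · obtain ⟨j, hj⟩ : ∃ j : ℕ, z = c - 1 + t + 1 + j := ⟨(z - (c - 1) - t - 1).toNat, by omega⟩
    rw [patch_of_gt _ _ hj]
    rcases j with _ | _ | j
    · rw [patch_of_mem f g (by omega) (by omega)]; exact congrArg x (by omega)
    · rw [patch_of_mem f g (by omega) (by omega)]; exact congrArg x (by omega)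
    · rw [patch_of_gt f g (j := j) (by omega)]; rfl
  · rw [patch_of_mem _ _ (by omega) (by omega), patch_of_mem f g (by omega) (by omega)]

theorem patch_self {β : Type*} (x : ℤ → Option β) (c : ℤ) (t : ℕ) (f g : ℕ → Option β) :
    patch x c t (consSeq (x (c - 1 - t)) f, consSeq (x (c + 1 + t)) g) =
      patch x c (t + 1) (f, g) := by
  funext z
  by_cases h1 : z < c - t
  · obtain ⟨j, hj⟩ : ∃ j : ℕ, z = c - t - 1 - j := ⟨(c - t - 1 - z).toNat, by omega⟩
    rw [patch_of_lt _ _ hj]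
    rcases j with _ | j
    · rw [patch_of_mem f g (by omega) (by omega)]; exact congrArg x (by omega)
    · rw [patch_of_lt f g (j := j) (by omega)]; rfl
  by_cases h2 : c + t < z
  · obtain ⟨j, hj⟩ : ∃ j : ℕ, z = c + t + 1 + j := ⟨(z - c - t - 1).toNat, by omega⟩
    rw [patch_of_gt _ _ hj]
    rcases j with _ | j
    · rw [patch_of_mem f g (by omega) (by omega)]; exact congrArg x (by omega)
    · rw [patch_of_gt f g (j := j) (by omega)]; rfl
  · rw [patch_of_mem _ _ (by omega) (by omega), patch_of_mem f g (by omega) (by omega)]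

theorem patch_add_one {β : Type*} (x : ℤ → Option β) (c : ℤ) (t : ℕ) (f g : ℕ → Option β) :
    patch x (c + 1) t (consSeq (x (c - t)) (consSeq (x (c - 1 - t)) f), g) =
      patch x c (t + 1) (f, g) := by
  funext z
  by_cases h1 : z < c + 1 - t
  · obtain ⟨j, hj⟩ : ∃ j : ℕ, z = c + 1 - t - 1 - j := ⟨(c + 1 - t - 1 - z).toNat, by omega⟩
    rw [patch_of_lt _ _ hj]
    rcases j with _ | _ | j
    · rw [patch_of_mem f g (by omega) (by omega)]; exact congrArg x (by omega)
    · rw [patch_of_mem f g (by omega) (by omega)]; exact congrArg x (by omega)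
    · rw [patch_of_lt f g (j := j) (by omega)]; rfl
  by_cases h2 : c + 1 + t < z
  · obtain ⟨j, hj⟩ : ∃ j : ℕ, z = c + 1 + t + 1 + j := ⟨(z - (c + 1) - t - 1).toNat, by omega⟩
    rw [patch_of_gt _ _ hj, patch_of_gt f g (j := j) (by omega)]
  · rw [patch_of_mem _ _ (by omega) (by omega), patch_of_mem f g (by omega) (by omega)]

/-- The cell `0` has then seen the whole word, so the blank guess is the correct one. -/
theorem patch_tape_none {α : Type*} (w : List α) :
    patch (tape w) 0 w.length (fun _ => none, fun _ => none) = tape w := by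
  funext z
  simp only [patch]
  split_ifs with h1 h2
  · exact (tape_of_neg w (by omega)).symm
  · obtain ⟨j, rfl⟩ := Int.eq_ofNat_of_zero_le (show 0 ≤ z by omega)
    rw [tape_natCast, eq_comm, List.getElem?_eq_none_iff]
    omega
  · rfl

/-- A rule started from a sliding block code of the tape is simulated, without delay, by a rule
started from the tape itself. -/
theorem exists_caRun_of_slide {α : Type u} [Finite α] {S : Type} [Finite S] {R : ℕ}
    {ι : (ℤ → Option α) → S} (hι : IsLocal R ι) (δ : S → S → S → S) :
    ∃ (S' : Type) (_ : Finite S') (i : Option α → S') (δ' : S' → S' → S' → S') (out : S' → S),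
      Function.Injective i ∧ ∀ w : List α,
        out (caRun δ' (fun c => i (tape w c)) w.length 0) =
          caRun δ (slide ι (tape w)) w.length 0 := by
  obtain ⟨n, ⟨e⟩⟩ := Finite.exists_equiv_fin (Option α)
  let H := (Fin R → Fin n) × (Fin R → Fin n)
  let ext : H → (ℕ → Option α) × (ℕ → Option α) := fun p =>
    (padNone fun j => e.symm (p.1 j), padNone fun j => e.symm (p.2 j))
  let cut : (ℕ → Option α) × (ℕ → Option α) → H := fun p =>
    (fun j => e (p.1 j), fun j => e (p.2 j))
  -- A cell holds the extreme letters of its window and the simulated state as a function of a guess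
  -- of the `R` letters beyond each end, the only unseen ones on which this state depends.
  let S' := Fin n × Fin n × (H → S)
  let i : Option α → S' := fun a =>
    (e a, e a, fun p => ι fun j => patch (fun _ => a) 0 0 (ext p) j)
  let δ' : S' → S' → S' → S' := fun l m r =>
    (l.1, r.2.1, fun p =>
      let x := (ext p).1
      let y := (ext p).2
      δ (l.2.2 (cut (x, consSeq (e.symm m.2.1) (consSeq (e.symm r.2.1) y))))
        (m.2.2 (cut (consSeq (e.symm l.1) x, consSeq (e.symm r.2.1) y)))
        (r.2.2 (cut (consSeq (e.symm m.1) (consSeq (e.symm l.1) x), y))))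
  have hcut : ∀ p j, j < R → (ext (cut p)).1 j = p.1 j ∧ (ext (cut p)).2 j = p.2 j := by
    intro p j hj
    simp [ext, cut, padNone, hj]
  have hpatch : ∀ (x : ℤ → Option α) (c : ℤ) (t : ℕ) (p : (ℕ → Option α) × (ℕ → Option α)),
      caRun δ (slide ι (patch x c t (ext (cut p)))) t c =
        caRun δ (slide ι (patch x c t p)) t c := by
    intro x c t p
    refine caRun_slide_congr hι t c fun z hz => ?_
    rw [abs_le] at hz
    simp only [patch]
    split_ifs with h1 h2
    · exact (hcut p _ (by omega)).1
    · exact (hcut p _ (by omega)).2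
    · rfl
  have key : ∀ (w : List α) (t : ℕ) (c : ℤ), caRun δ' (fun c => i (tape w c)) t c =
      (e (tape w (c - t)), e (tape w (c + t)),
        fun p => caRun δ (slide ι (patch (tape w) c t (ext p))) t c) := by
    intro w t
    induction t with
    | zero =>
      intro c
      refine Prod.ext (by simp [caRun_zero, i]) (Prod.ext (by simp [caRun_zero, i])
        (funext fun p => ?_))
      exact hι _ _ fun j _ => patch_center _ _ _ _
    | succ t ih =>
      intro c
      rw [caRun_succ, ih, ih, ih]
      simp only [δ', Equiv.symm_apply_apply, hpatch, patch_sub_one, patch_self, patch_add_one]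
      refine Prod.ext ?_ (Prod.ext ?_ rfl)
      · simp only; congr 2; push_cast; ring
      · simp only; congr 2; push_cast; ring
  refine ⟨S', inferInstance, i, δ', fun s => s.2.2 (cut (fun _ => none, fun _ => none)), ?_, ?_⟩
  · intro a b hab
    exact e.injective (congrArg Prod.fst hab)
  · intro w
    rw [key]
    simp only
    rw [hpatch, patch_tape_none]

/-! ### Quiescent state and real-time recognition. -/

/-- A rule started from an injective code of the tape is a cellular automaton with a quiescent
state: a quiescent cell stands for the common state of all cells far from the input. -/
theorem exists_cellularAutomaton {α : Type u} {S : Type} [Finite S] {i : Option α → S}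
    (hi : Function.Injective i) (δ : S → S → S → S) (acc : S → Prop) (e : Prop) :
    ∃ C : CellularAutomaton α, ∀ w : List α, w ∈ C.realTimeLanguage ↔
      (w = [] ∧ e) ∨ (w ≠ [] ∧ acc (caRun δ (fun c => i (tape w c)) w.length 0)) := by
  -- In `some (b, s)`, `s` is the simulated state and `b` the current state of the blank background;
  -- `b` lets a cell decode its quiescent neighbours.
  let value : S → Option (S × S) → S := fun b x => x.elim b Prod.snd
  let lit : S → Option (S × S) → Option (S × S) → Option (S × S) → Option (S × S) :=
    fun b l m r => some (δ b b b, δ (value b l) (value b m) (value b r))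
  let step : Option (S × S) → Option (S × S) → Option (S × S) → Option (S × S) := fun l m r =>
    match m, l, r with
    | some x, _, _ => lit x.1 l m r
    | none, some x, _ => lit x.1 l m r
    | none, none, some x => lit x.1 l m r
    | none, none, none => none
  let C : CellularAutomaton α :=
    { State := Option (S × S)
      finite_state := inferInstance
      letter := ⟨fun a => some (i none, i (some a)), fun a b h => by
        simpa using hi (congrArg Prod.snd (Option.some.inj h))⟩
      quiescent := none
      quiescent_not_letter := fun a => by simp
      accept := {x | x.elim e fun s => acc s.2}
      step := step
      step_quiescent := rfl }
  refine ⟨C, fun w => ?_⟩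
  let b : ℕ → S := fun t => Nat.rec (i none) (fun _ s => δ s s s) t
  have hinit : ∀ c, C.initial w c = (tape w c).elim none fun a => some (i none, i (some a)) := by
    rintro (c | c) <;> rfl
  have key : ∀ t c, value (b t) (C.config w t c) = caRun δ (fun c => i (tape w c)) t c ∧
      ∀ x, C.config w t c = some x → x.1 = b t := by
    intro t
    induction t with
    | zero =>
      intro c
      change value (b 0) (C.initial w c) = i (tape w c) ∧ ∀ x, C.initial w c = some x → _
      rw [hinit]
      cases tape w c with
      | none => simp [value, b]
      | some a =>
        exact ⟨rfl, fun x hx => (congrArg Prod.fst (Option.some.inj hx)).symm⟩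
    | succ t ih =>
      intro c
      rw [caRun_succ, ← (ih _).1, ← (ih _).1, ← (ih _).1]
      change value _ (step (C.config w t (c - 1)) (C.config w t c) (C.config w t (c + 1))) = _ ∧
        ∀ x, step (C.config w t (c - 1)) (C.config w t c) (C.config w t (c + 1)) = some x → _
      have hl := (ih (c - 1)).2
      have hm := (ih c).2
      have hr := (ih (c + 1)).2
      generalize C.config w t (c - 1) = l at *
      generalize C.config w t c = m at *
      generalize C.config w t (c + 1) = r at *
      have hlit : ∀ b', b' = b t → value (b (t + 1)) (lit b' l m r) =
          δ (value (b t) l) (value (b t) m) (value (b t) r) ∧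
            ∀ x, lit b' l m r = some x → x.1 = b (t + 1) := by
        rintro _ rfl
        exact ⟨rfl, fun x hx => (congrArg Prod.fst (Option.some.inj hx)).symm⟩
      rcases m with _ | m
      · rcases l with _ | l
        · rcases r with _ | r
          · exact ⟨rfl, fun x hx => by cases hx⟩
          · exact hlit _ (hr r rfl)
        · exact hlit _ (hl l rfl)
      · exact hlit _ (hm m rfl)
  change (C.config w w.length 0).elim e (fun s => acc s.2) ↔ _
  by_cases hw : w = []
  · subst hw
    simp only [true_and, ne_eq, not_true_eq_false, false_and, or_false]
    rfl
  -- A cell that is not quiescent never becomes so; hence `e` matters for the empty word only.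
  · have hne : ∀ t, C.config w t 0 ≠ none := by
      intro t
      induction t with
      | zero =>
        change C.initial w 0 ≠ none
        rw [hinit, ← Nat.cast_zero, tape_natCast, List.getElem?_eq_getElem
          (List.length_pos_iff.2 hw)]
        simp
      | succ t ih =>
        change step (C.config w t (0 - 1)) (C.config w t 0) (C.config w t (0 + 1)) ≠ none
        obtain ⟨x, hx⟩ := Option.ne_none_iff_exists'.1 ih
        rw [hx]
        simp [step, lit]
    obtain ⟨x, hx⟩ := Option.ne_none_iff_exists'.1 (hne w.length)
    have h := (key w.length 0).1
    rw [hx] at h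
    simp only [hw, false_and, ne_eq, not_false_eq_true, true_and, false_or, ← h, hx]
    rfl

/-- A language decided, on nonempty words, by a CA field at the cell `0` at the time given by the
length of the word is a real-time language. -/
theorem exists_realTimeLanguage_eq {α : Type u} [Finite α] {φ : List α → ℤ → ℕ → Prop}
    (hφ : IsCAField φ) {L : Language α} (hL : ∀ w, w ≠ [] → (φ w 0 w.length ↔ w ∈ L)) :
    ∃ C : CellularAutomaton α, C.realTimeLanguage = L := by
  obtain ⟨S, hS, R, ι, δ, out, hι, hrun⟩ := hφ
  obtain ⟨S', hS', i, δ', out', hi, hout⟩ := exists_caRun_of_slide hι δ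
  obtain ⟨C, hC⟩ := exists_cellularAutomaton hi δ' (fun s => out (out' s)) ([] ∈ L)
  refine ⟨C, Set.ext fun w => ?_⟩
  refine (hC w).trans ?_
  by_cases hw : w = []
  · simp only [hw, true_and, ne_eq, not_true_eq_false, false_and, or_false]
    exact Iff.rfl
  · rw [hout, ← hrun w hw, hL w hw]
    simp only [hw, false_and, ne_eq, not_false_eq_true, true_and, false_or]
    exact Iff.rfl

/-! ### Signals, moving tapes and compositions along diagonals. -/

/-- The cells reached by a signal that starts from the cell `0` and moves one cell to the right
every `N - 1` steps. -/
def Active (N : ℕ) (c : ℤ) (t : ℕ) : Prop := 0 ≤ c ∧ N * c ≤ c + t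

theorem Active.succ {N : ℕ} {c : ℤ} {t : ℕ} (h : Active N c t) : Active N c (t + 1) :=
  ⟨h.1, by have := h.2; push_cast; omega⟩

theorem active_zero_iff {N : ℕ} (hN : 2 ≤ N) {c : ℤ} : Active N c 0 ↔ c = 0 := by
  constructor
  · rintro ⟨h0, h⟩
    have : (2 : ℤ) ≤ N := by exact_mod_cast hN
    simp only [Nat.cast_zero, add_zero] at h
    nlinarith
  · rintro rfl
    simp [Active]

/-- The front enters the cell `c` at time `(N - 1) c`, so a clock modulo `N - 1` tells it when to
advance. -/
theorem active_succ_iff {N : ℕ} (hN : 2 ≤ N) {c : ℤ} {t : ℕ} :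
    Active N c (t + 1) ↔ Active N c t ∨ ((N - 1 ∣ t + 1) ∧ Active N (c - 1) t) := by
  obtain ⟨P, rfl⟩ : ∃ P, N = P + 1 := ⟨N - 1, by omega⟩
  have hP : (1 : ℤ) ≤ P := by exact_mod_cast (show 1 ≤ P by omega)
  rw [Nat.add_sub_cancel]
  constructor
  · rintro ⟨h0, h⟩
    by_cases hact : Active (P + 1) c t
    · exact Or.inl hact
    · have hlt : ¬ ((P + 1 : ℕ) : ℤ) * c ≤ c + t := fun h' => hact ⟨h0, h'⟩
      push_cast at h hlt
      have heq : (t : ℤ) + 1 = P * c := by linarith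
      refine Or.inr ⟨?_, ?_, ?_⟩
      · have : (P : ℤ) ∣ ((t + 1 : ℕ) : ℤ) := ⟨c, by push_cast; exact heq⟩
        exact_mod_cast this
      · nlinarith
      · push_cast; linarith
  · rintro (h | ⟨⟨d, hd⟩, h0, h⟩)
    · exact h.succ
    · have hd' : (t : ℤ) + 1 = P * d := by exact_mod_cast hd
      refine ⟨by omega, ?_⟩
      push_cast at h ⊢
      have hcd : c - 1 < d := by
        by_contra hcon
        have : (d : ℤ) ≤ c - 1 := by omega
        nlinarith
      nlinarith

namespace IsCAField

variable {α : Type u} [Finite α]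

theorem cell_eq_zero : IsCAField fun (_ : List α) c (_ : ℕ) => c = 0 := by
  refine (((tape_shift (α := α) (-1)).map₂ (tape_shift 0))
    fun a b => a = none ∧ b ≠ none).congr fun w hw c _ => propext ?_
  rw [add_zero]
  constructor
  · rintro rfl
    refine ⟨tape_of_neg w (by omega), ?_⟩
    rw [← Nat.cast_zero, tape_natCast, List.getElem?_eq_getElem (List.length_pos_iff.2 hw)]
    simp
  · rintro ⟨h1, h2⟩
    by_contra hc
    rcases lt_or_gt_of_ne hc with hc | hc
    · exact h2 (tape_of_neg w hc)
    · obtain ⟨j, rfl⟩ : ∃ j : ℕ, c = j + 1 := ⟨(c - 1).toNat, by omega⟩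
      rw [← sub_eq_add_neg, add_sub_cancel_right, tape_natCast, List.getElem?_eq_none_iff] at h1
      apply h2
      have : ((j : ℤ) + 1) = ((j + 1 : ℕ) : ℤ) := by push_cast; ring
      rw [this, tape_natCast, List.getElem?_eq_none_iff]
      omega

theorem active {N : ℕ} (hN : 2 ≤ N) : IsCAField fun (_ : List α) c t => Active N c t := by
  have hper : IsCAField fun (_ : List α) (_ : ℤ) t => N - 1 ∣ t :=
    of_periodic (P := N - 1) (by omega) fun t => by simp
  refine (cell_eq_zero.prod hper).recursion (fun p => p.1)
    (fun l m _ _ p => m ∨ (p.2 ∧ l)) ?_ ?_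
  · exact fun w _ c => propext (active_zero_iff hN)
  · exact fun w _ c t => propext (active_succ_iff hN)

/-- On its active cells, the residue modulo `N` of the index `c + t` of the diagonal. -/
theorem active_and_dvd {N : ℕ} (hN : 2 ≤ N) :
    IsCAField fun (_ : List α) c t => Active N c t ∧ (N : ℤ) ∣ c + t := by
  classical
  have : NeZero N := ⟨by omega⟩
  -- The front arrives at `c` when `c + t = N c`, so a counter started at `0` on arrival has the
  -- right residue.
  have hκ : IsCAField fun (_ : List α) c t =>
      if Active N c t then ((c + t : ℤ) : ZMod N) else 0 := by
    refine (active hN).recursion (fun _ => 0)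
      (fun _ m _ a a' => if a' then (if a then m + 1 else 0) else 0) ?_ ?_
    · intro w _ c
      split_ifs with h
      · simp [(active_zero_iff hN).1 h]
      · rfl
    · intro w _ c t
      split_ifs with h h'
      · push_cast; ring
      · have h1 := h.2
        have h2 : ¬ (N : ℤ) * c ≤ c + t := fun h2 => h' ⟨h.1, h2⟩
        have : c + ((t + 1 : ℕ) : ℤ) = N * c := by push_cast at *; omega
        rw [this]
        simp
      · rfl
  refine ((active hN).map₂ hκ fun a z => a ∧ z = 0).congr fun w _ c t => propext ?_
  refine and_congr_right fun h => ?_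
  rw [if_pos h, ZMod.intCast_zmod_eq_zero_iff_dvd]

/-- The tape moving with rational speed `p / P`, where `|p| ≤ P`. -/
theorem tape_speed {P : ℕ} (hP : 0 < P) {p : ℤ} (hp : |p| ≤ P) (b : ℤ) :
    IsCAField fun (w : List α) c t => tape w (c + p * t / P + b) := by
  have hP' : (0 : ℤ) < P := by exact_mod_cast hP
  rw [abs_le] at hp
  -- The increments of the rounded displacement are periodic in time, and `|p| ≤ P` confines them to
  -- `-1`, `0`, `1`.
  have hdir : IsCAField fun (_ : List α) (_ : ℤ) t =>
      p * ((t + 1 : ℕ) : ℤ) / P - p * t / P := by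
    refine of_periodic hP fun t => ?_
    have h1 : p * ((t + P + 1 : ℕ) : ℤ) = p * ((t + 1 : ℕ) : ℤ) + p * P := by push_cast; ring
    have h2 : p * ((t + P : ℕ) : ℤ) = p * (t : ℤ) + p * P := by push_cast; ring
    rw [h1, h2, Int.add_mul_ediv_right _ _ hP'.ne', Int.add_mul_ediv_right _ _ hP'.ne']
    ring
  refine ((tape_shift b).prod hdir).recursion (fun q => q.1)
    (fun l m r q _ => if q.2 = -1 then l else if q.2 = 0 then m else r) ?_ ?_
  · intro w _ c
    simp
  · intro w _ c t
    have hlo : p * t / P - 1 ≤ p * ((t + 1 : ℕ) : ℤ) / P := by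
      rw [Int.le_ediv_iff_mul_le hP']
      have := Int.ediv_mul_le (p * t) hP'.ne'
      push_cast
      nlinarith
    have hhi : p * ((t + 1 : ℕ) : ℤ) / P < p * t / P + 2 := by
      rw [Int.ediv_lt_iff_lt_mul hP']
      have := Int.lt_ediv_add_one_mul_self (p * t) hP'
      push_cast
      nlinarith
    split_ifs with h1 h2
    · exact congrArg (tape w) (by omega)
    · exact congrArg (tape w) (by omega)
    · exact congrArg (tape w) (by omega)

end IsCAField

theorem Int.ediv_of_dvd_add_one {N a : ℤ} (hN : 0 < N) (h : N ∣ a + 1) :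
    a / N = (a + 1) / N - 1 := by
  obtain ⟨q, hq⟩ := h
  rw [hq, Int.mul_ediv_cancel_left _ hN.ne', Int.ediv_eq_iff_of_pos hN]
  constructor <;> nlinarith

theorem Int.ediv_add_one_of_not_dvd {N a : ℤ} (hN : 0 < N) (h : ¬ N ∣ a + 1) :
    (a + 1) / N = a / N := by
  rw [Int.ediv_eq_iff_of_pos hN]
  have h1 := Int.ediv_mul_le a hN.ne'
  have h2 := Int.lt_ediv_add_one_mul_self a hN
  refine ⟨by nlinarith, ?_⟩
  have h3 : a + 1 ≠ (a / N + 1) * N := fun h3 => h ⟨a / N + 1, by rw [h3]; ring⟩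
  have h4 : a + 1 ≤ (a / N + 1) * N := by omega
  have := lt_of_le_of_ne h4 h3
  nlinarith

/-- The cell `c` meets on the diagonal `c + t = N m`, for `m ≥ c`, the letter at the position
`A m + D c + B`. -/
theorem exists_letter_field {α : Type u} [Finite α] {N A D : ℕ} (hN : 2 ≤ N) (hAD : A + D ≤ N) (B : ℕ) :
    ∃ ψ : List α → ℤ → ℕ → Option α, IsCAField ψ ∧ ∀ w, w ≠ [] → ∀ m c t : ℕ, c ≤ m →
      c + t = N * m → ψ w c t = tape w (A * m + D * c + B : ℕ) := by
  classical
  have hN0 : (0 : ℤ) < N := by exact_mod_cast (show 0 < N by omega)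
  let K := A + D
  -- At the arrival time `(N - 1) c` of the front, a tape of speed `(K - 1) / (N - 1)` shows at `c`
  -- the letter at `K c + b + B`: this initialises the block stored in `c`.
  let Z : Fin (K + 1) → List α → ℤ → ℕ → Option α := fun b w c t =>
    tape w (c + (K - 1) * t / (N - 1 : ℕ) + (b + B : ℕ))
  have hZ : ∀ b, IsCAField (Z b) := fun b => IsCAField.tape_speed (by omega)
    (by rw [abs_le]; omega) _
  -- On each new diagonal the block of `K + 1` letters advances by `A`. The letters missing in `c`
  -- are held by `c + 1`, which met this diagonal one step earlier and whose block starts `D = K -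
  -- A` further.
  let X : List α → ℤ → ℕ → Fin (K + 1) → Option α := fun w c t b =>
    if Active N c t then tape w (K * c + A * ((c + t) / N - c) + (b + B : ℕ)) else none
  have hZ0 : ∀ w c t, Active N c (t + 1) → ¬ Active N c t → (fun b => Z b w c (t + 1)) =
      X w c (t + 1) := by
    intro w c t h h'
    have heq : c + ((t + 1 : ℕ) : ℤ) = N * c := by
      have h1 := h.2
      have h2 : ¬ (N : ℤ) * c ≤ c + t := fun h2 => h' ⟨h.1, h2⟩
      push_cast at *; omega
    have heq' : ((t + 1 : ℕ) : ℤ) = (N - 1 : ℕ) * c := by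
      rw [Nat.cast_sub (by omega)]; push_cast at *; linarith
    funext b
    simp only [X, Z, if_pos h]
    rw [heq, heq', Int.mul_ediv_cancel_left _ hN0.ne', mul_left_comm,
      Int.mul_ediv_cancel_left _ (by omega)]
    exact congrArg (tape w) (by ring)
  have hX : IsCAField X := by
    refine ((IsCAField.pi hZ).prod ((IsCAField.active hN).prod
      (IsCAField.active_and_dvd hN))).recursion
      (fun u => if u.2.1 then u.1 else fun _ => none)
      (fun _ m r u u' => if u'.2.1 then
        (if u.2.1 then
          (if u'.2.2 then fun b => if h : (b : ℕ) + A ≤ K then m ⟨b + A, by omega⟩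
            else r ⟨b + A - K, by omega⟩
          else m)
        else u'.1)
        else fun _ => none) ?_ ?_
    · intro w _ c
      split_ifs with h
      · funext b
        simp only at h
        simp only [X, Z, if_pos h]
        simp [(active_zero_iff hN).1 h]
      · funext b
        exact if_neg h
    · intro w _ c t
      split_ifs with h h' hd
      · simp only at h h' hd
        funext b
        have hdvd : (N : ℤ) ∣ c + t + 1 := by simpa [add_assoc] using hd.2
        have hdiv := Int.ediv_of_dvd_add_one hN0 hdvd
        simp only [X, if_pos h]
        by_cases hb : (b : ℕ) + A ≤ K
        · rw [dif_pos hb, if_pos h', show c + ((t + 1 : ℕ) : ℤ) = c + t + 1 by push_cast; ring, hdiv]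
          exact congrArg (tape w) (by push_cast; ring)
        · have hact : Active N (c + 1) t := by
            refine ⟨by have := h.1; omega, ?_⟩
            obtain ⟨q, hq⟩ := hdvd
            have h2 := h'.2
            have hcq : c < q := lt_of_mul_lt_mul_left (by omega : (N : ℤ) * c < N * q) hN0.le
            nlinarith
          rw [dif_neg hb, if_pos hact, show c + ((t + 1 : ℕ) : ℤ) = c + t + 1 by push_cast; ring,
            show c + 1 + (t : ℤ) = c + t + 1 by ring, Nat.cast_add (b + A - K),
            Nat.cast_sub (by omega)]
          exact congrArg (tape w) (by push_cast; ring)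
      · simp only at h h' hd
        have hdvd : ¬ (N : ℤ) ∣ c + t + 1 := fun hdvd => hd ⟨h, by push_cast; rwa [← add_assoc]⟩
        funext b
        simp only [X, if_pos h, if_pos h']
        rw [show c + ((t + 1 : ℕ) : ℤ) = c + t + 1 by push_cast; ring,
          Int.ediv_add_one_of_not_dvd hN0 hdvd]
      · exact (hZ0 w c t h h').symm
      · funext b
        exact if_neg h
  refine ⟨fun w c t => X w c t 0, hX.comp fun x => x 0, fun w _ m c t hcm hct => ?_⟩
  have hct' : (c : ℤ) + t = N * m := by exact_mod_cast hct
  have hact : Active N c t := ⟨by omega, by rw [hct']; gcongr⟩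
  simp only [X, if_pos hact]
  rw [hct', Int.mul_ediv_cancel_left _ hN0.ne']
  exact congrArg (tape w) (by simp [K]; ring)

/-- The maps `γ w c` met by the cells `c < m` on the diagonal `c + t = N m` can be composed along
this diagonal. -/
theorem exists_composition_field {α : Type u} [Finite α] {Q : Type*} [Finite Q] {N : ℕ} (hN : 2 ≤ N)
    {γ : List α → ℤ → ℕ → Q → Q} (hγ : IsCAField γ) :
    ∃ φ : List α → ℤ → ℕ → Q → Q, IsCAField φ ∧ ∀ w (m : ℕ) (s : ℕ → Q),
      (∀ c t : ℕ, c < m → c + t = N * m → γ w c t (s c) = s (c + 1)) →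
        φ w 0 (N * m) (s 0) = s m := by
  classical
  obtain ⟨φ, hφ, h0, hs⟩ := (hγ.prod ((IsCAField.active hN).prod
    (IsCAField.active_and_dvd hN))).exists_recursion (T := Q → Q) (fun _ => id)
    -- Asking for activity one step earlier excludes the cell `c = m`, which the front has only just
    -- reached: there the product restarts from `id`.
    (fun _ _ r u u' => if u.2.1 ∧ u'.2.2 then r ∘ u'.1 else id)
  refine ⟨φ, hφ, fun w m s hst => ?_⟩
  have key : ∀ d c t : ℕ, c + d = m → c + t = N * m → φ w c t (s c) = s m := by
    intro d
    induction d with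
    | zero =>
      rintro c t rfl ht
      rcases t with _ | t
      · rw [h0]; rfl
      · rw [hs, if_neg]
        · rfl
        · rintro ⟨⟨-, h⟩, -⟩
          have : (c : ℤ) + (t + 1) = N * c := by exact_mod_cast ht
          omega
    | succ d ih =>
      intro c t hd ht
      have hle : 2 * m ≤ N * m := Nat.mul_le_mul_right m hN
      obtain ⟨t, rfl⟩ : ∃ t', t = t' + 1 := ⟨t - 1, by omega⟩
      have ht' : (c : ℤ) + (t + 1) = N * m := by exact_mod_cast ht
      have hm : N * c + N * 1 ≤ N * m := by
        rw [← Nat.mul_add]; exact Nat.mul_le_mul_left N (by omega)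
      have hm' : (N : ℤ) * c + N * 1 ≤ N * m := by exact_mod_cast hm
      have hact : Active N c t := ⟨by omega, by omega⟩
      have hdvd : (N : ℤ) ∣ c + ((t + 1 : ℕ) : ℤ) := ⟨m, by push_cast; exact ht'⟩
      rw [hs, if_pos ⟨hact, hact.succ, hdvd⟩]
      simp only [Function.comp]
      rw [hst c (t + 1) (by omega) ht]
      exact_mod_cast ih (c + 1) t (by omega) (by omega)
  exact_mod_cast key m 0 (N * m) (by omega) (by omega)

/-! ### Runs of the automaton while the symbols read are constant. -/

namespace OneWayMultiheadDFA

variable {α : Type u} {k : ℕ} (F : OneWayMultiheadDFA.{u, v} α k)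

/-- The state reached from `q` after reading the letters `l 0, …, l (s - 1)`. -/
def stateRun (q : F.State) (l : ℕ → Fin k → Option α) : ℕ → F.State
  | 0 => q
  | s + 1 => (F.step (stateRun q l s) (l s)).1

/-- The displacements of the heads and the state after `s` steps from the state `q` when the heads
constantly read `r`. -/
def constRun (r : Fin k → Option α) (q : F.State) : ℕ → (Fin k → ℕ) × F.State
  | 0 => (fun _ => 0, q)
  | s + 1 =>
    (fun i => (constRun r q s).1 i + if (F.step (constRun r q s).2 r).2 i = true then 1 else 0,
      (F.step (constRun r q s).2 r).1)

variable {F}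

theorem stateRun_congr {q : F.State} {l l' : ℕ → Fin k → Option α} {s : ℕ}
    (h : ∀ j < s, l j = l' j) : F.stateRun q l s = F.stateRun q l' s := by
  induction s with
  | zero => rfl
  | succ s ih =>
    simp only [stateRun]
    rw [ih fun j hj => h j (by omega), h s (by omega)]

theorem config_add_snd (w : List α) (t s : ℕ) : (F.config w (t + s)).2 =
    F.stateRun (F.config w t).2 (fun j i => w[(F.config w (t + j)).1 i]?) s := by
  induction s with
  | zero => rfl
  | succ s ih =>
    simp only [stateRun]
    rw [← ih]
    rfl

variable {r : Fin k → Option α} {q : F.State}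

theorem constRun_add (s s' : ℕ) : F.constRun r q (s + s') =
    (fun i => (F.constRun r q s).1 i + (F.constRun r (F.constRun r q s).2 s').1 i,
      (F.constRun r (F.constRun r q s).2 s').2) := by
  induction s' with
  | zero => rfl
  | succ s' ih =>
    rw [← Nat.add_assoc, constRun, ih]
    simp only [constRun, Nat.add_assoc]

theorem constRun_fst_succ_le (s : ℕ) (i : Fin k) :
    (F.constRun r q (s + 1)).1 i ≤ (F.constRun r q s).1 i + 1 := by
  simp only [constRun]
  split_ifs <;> omega

theorem constRun_fst_mono (i : Fin k) : Monotone fun s => (F.constRun r q s).1 i :=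
  monotone_nat_of_le_succ fun s => by simp [constRun]

theorem constRun_fst_le (s : ℕ) (i : Fin k) : (F.constRun r q s).1 i ≤ s := by
  induction s with
  | zero => exact le_rfl
  | succ s ih => exact (constRun_fst_succ_le s i).trans (by omega)

theorem constRun_fst_eq_zero {i : Fin k} (hi : r i = none) (s : ℕ) :
    (F.constRun r q s).1 i = 0 := by
  induction s with
  | zero => rfl
  | succ s ih => simp [constRun, ih, F.step_endMarker _ _ _ hi]

theorem constRun_mul {p : ℕ} (hp : (F.constRun r q p).2 = q) (u : ℕ) :
    F.constRun r q (p * u) = (fun i => u * (F.constRun r q p).1 i, q) := by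
  induction u with
  | zero => simp [constRun]
  | succ u ih =>
    rw [Nat.mul_succ, constRun_add, ih]
    refine Prod.ext (funext fun i => ?_) hp
    simp only
    ring

theorem IsOblivious.config_fst_eq (hF : F.IsOblivious) {w w' : List α}
    (h : w.length = w'.length) (t : ℕ) : (F.config w t).1 = (F.config w' t).1 := by
  obtain ⟨f, hf⟩ := hF
  rw [hf, hf, h]

theorem config_add_eq_constRun {w : List α} {t s : ℕ}
    (h : ∀ j < s, ∀ i, w[(F.config w t).1 i + (F.constRun r (F.config w t).2 j).1 i]? = r i) :
    F.config w (t + s) =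
      (fun i => (F.config w t).1 i + (F.constRun r (F.config w t).2 s).1 i,
        (F.constRun r (F.config w t).2 s).2) := by
  induction s with
  | zero => rfl
  | succ s ih =>
    rw [← Nat.add_assoc, config, ih fun j hj => h j (by omega)]
    simp only [h s (by omega), constRun]
    refine Prod.ext (funext fun i => ?_) rfl
    simp only
    split_ifs <;> ring

/-- As long as the word `a ^ n` is read constantly, the heads follow the constant run on all words
of length `n`. -/
theorem IsOblivious.config_add_fst (hF : F.IsOblivious) {a : α} {n t s : ℕ} {x : Fin k → ℕ}
    (hx : ∀ w : List α, w.length = n → ∀ i, (F.config w t).1 i = x i)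
    (hq : (F.config (List.replicate n a) t).2 = q)
    (hr : ∀ i, (r i = none ∧ x i = n) ∨
      (r i = some a ∧ ∀ j < s, x i + (F.constRun r q j).1 i < n)) :
    (∀ j ≤ s, ∀ w : List α, w.length = n → ∀ i,
        (F.config w (t + j)).1 i = x i + (F.constRun r q j).1 i) ∧
      (F.config (List.replicate n a) (t + s)).2 = (F.constRun r q s).2 := by
  subst hq
  have hlen : (List.replicate n a).length = n := List.length_replicate
  have key : ∀ j ≤ s, F.config (List.replicate n a) (t + j) =
      (fun i => x i + (F.constRun r (F.config (List.replicate n a) t).2 j).1 i,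
        (F.constRun r (F.config (List.replicate n a) t).2 j).2) := by
    intro j hj
    rw [config_add_eq_constRun (r := r)]
    · simp only [hx _ hlen]
    · intro j' hj' i
      rw [hx _ hlen]
      rcases hr i with ⟨h1, h2⟩ | ⟨h1, h2⟩
      · rw [constRun_fst_eq_zero h1, h1, h2, List.getElem?_eq_none_iff]
        simp
      · rw [h1, List.getElem?_replicate, if_pos (h2 j' (by omega))]
  refine ⟨fun j hj w hw i => ?_, ?_⟩
  · rw [hF.config_fst_eq (hw.trans hlen.symm), key j hj]
  · rw [key s le_rfl]

/-! ### Phases of the run and progressions of lengths. -/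

variable (F)

/-- On all words of length `N m + ρ`, the heads are at some time at the positions `A i m + B i`,
the computation has not ended before, and the state at that time is given by a CA field at the
cell `0` at the time given by the length; on the word `a ^ (N m + ρ)` this state is `q`. -/
def Reaches (a : α) (N ρ : ℕ) (A B : Fin k → ℕ) (q : F.State) : Prop :=
  ∃ (τ : ℕ → ℕ) (φ : List α → ℤ → ℕ → F.State), IsCAField φ ∧ ∀ m,
    (∀ w : List α, w.length = N * m + ρ → (∀ i, (F.config w (τ m)).1 i = A i * m + B i) ∧
      (∀ s < τ m, ¬ F.AllAtEnd w s) ∧ φ w 0 (N * m + ρ) = (F.config w (τ m)).2) ∧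
    (F.config (List.replicate (N * m + ρ) a) (τ m)).2 = q

/-- On the words of length `N m + ρ`, the language is decided by a CA field at the cell `0` at the
time given by the length. -/
def Decided (N ρ : ℕ) : Prop :=
  ∃ φ : List α → ℤ → ℕ → Prop, IsCAField φ ∧ ∀ m, ∀ w : List α, w.length = N * m + ρ →
    (φ w 0 (N * m + ρ) ↔ w ∈ F.language)

variable {F} {a : α} {N ρ : ℕ} {A B : Fin k → ℕ}

theorem mem_language_iff {w : List α} {t : ℕ} (ht : F.HaltsAt w t) :
    w ∈ F.language ↔ (F.config w t).2 ∈ F.accept := by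
  constructor
  · rintro ⟨t', ht', hacc⟩
    rcases lt_trichotomy t t' with h | h | h
    · exact absurd ht.1 (ht'.2 t h)
    · rwa [h]
    · exact absurd ht'.1 (ht.2 t' h)
  · exact fun h => ⟨t, ht, h⟩

theorem Reaches.decided_of_atEnd (h : F.Reaches a N ρ A B q) (hA : ∀ i, A i = N)
    (hB : ∀ i, B i = ρ) : F.Decided N ρ := by
  obtain ⟨τ, φ, hφ, hm⟩ := h
  refine ⟨fun w c t => φ w c t ∈ F.accept, hφ.comp fun p => p ∈ F.accept, fun m w hw => ?_⟩
  obtain ⟨hpos, hhalt, hst⟩ := (hm m).1 w hw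
  have hend : F.HaltsAt w (τ m) := ⟨fun i => by rw [hpos, hA, hB, hw], hhalt⟩
  rw [mem_language_iff hend, ← hst]

/-- A cycle without displacement keeps the head `i₀` off the end-marker forever, by obliviousness on
all words of the same length, so none of them is accepted. -/
theorem Reaches.decided_of_loop (hF : F.IsOblivious) (h : F.Reaches a N ρ A B q)
    (hA : ∀ i, A i ≤ N)
    (hr : ∀ i, (r i = none ∧ A i = N ∧ B i = ρ) ∨ (r i = some a ∧ B i < ρ))
    {p : ℕ} (hp : 0 < p) (hq : (F.constRun r q p).2 = q) (hd : ∀ i, (F.constRun r q p).1 i = 0)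
    {i₀ : Fin k} (hi₀ : r i₀ = some a) : F.Decided N ρ := by
  obtain ⟨τ, φ, hφ, hm⟩ := h
  refine ⟨fun _ _ _ => False, IsCAField.const False, fun m w hw => ?_⟩
  rw [false_iff]
  rintro ⟨t, ⟨ht, -⟩, -⟩
  obtain ⟨-, hhalt, -⟩ := (hm m).1 w hw
  obtain ⟨s, rfl⟩ := Nat.exists_eq_add_of_le (not_lt.1 fun hlt => hhalt t hlt ht)
  have hzero : ∀ j i, (F.constRun r q j).1 i = 0 := by
    intro j i
    have h1 := constRun_fst_mono (F := F) (r := r) (q := q) i (Nat.le_mul_of_pos_left j hp)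
    simp only [constRun_mul hq, hd, Nat.mul_zero] at h1
    omega
  have hlt : ∀ i, B i < ρ → A i * m + B i < N * m + ρ := fun i hi =>
    Nat.add_lt_add_of_le_of_lt (Nat.mul_le_mul_right m (hA i)) hi
  have hpos := (hF.config_add_fst (r := r) (s := s) (fun w hw => ((hm m).1 w hw).1) (hm m).2
    fun i => by
      rcases hr i with ⟨h1, h2, h3⟩ | ⟨h1, h2⟩
      · exact Or.inl ⟨h1, by rw [h2, h3]⟩
      · exact Or.inr ⟨h1, fun j _ => by rw [hzero]; exact hlt i h2⟩).1 s le_rfl w hw i₀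
  rw [ht i₀, hzero, hw] at hpos
  rcases hr i₀ with ⟨h1, -⟩ | ⟨-, h2⟩
  · simp [h1] at hi₀
  · have := hlt i₀ h2
    omega

/-- Replacing `m` by `m + s` moves a head with `A i < N` further from the end by `(N - A i) s`. The
finitely many lengths lost are recovered by `Decided.of_mul_add`. -/
theorem Reaches.shift (h : F.Reaches a N ρ A B q) (s : ℕ) :
    F.Reaches a N (N * s + ρ) A (fun i => A i * s + B i) q := by
  obtain ⟨τ, φ, hφ, hm⟩ := h
  have hlen : ∀ m, N * m + (N * s + ρ) = N * (m + s) + ρ := fun m => by ring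
  refine ⟨fun m => τ (m + s), φ, hφ, fun m => ?_⟩
  rw [hlen]
  obtain ⟨h1, h2⟩ := hm (m + s)
  refine ⟨fun w hw => ⟨fun i => ?_, (h1 w hw).2⟩, h2⟩
  rw [(h1 w hw).1]
  ring

/-- A constant number of steps. -/
theorem Reaches.run [Finite α] (hF : F.IsOblivious) (h : F.Reaches a N ρ A B q) (hN : 2 ≤ N)
    (hρ : 1 ≤ ρ) (hA : ∀ i, A i ≤ N) (s : ℕ)
    (hr : ∀ i, (r i = none ∧ A i = N ∧ B i = ρ) ∨
      (r i = some a ∧ ∀ j < s, B i + (F.constRun r q j).1 i < ρ))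
    {i₀ : Fin k} (hi₀ : r i₀ = some a) :
    F.Reaches a N ρ A (fun i => B i + (F.constRun r q s).1 i) (F.constRun r q s).2 := by
  have := F.finite_state
  obtain ⟨τ, φ, hφ, hm⟩ := h
  -- With `D = 0` the cell `0` alone meets the required letters, at time `N m`; a delay of `ρ`
  -- brings them to the time given by the length.
  choose ψ hψ hψl using fun (i : Fin k) (j : Fin s) =>
    exists_letter_field (α := α) (A := A i) (D := 0) hN (hA i) (B i + (F.constRun r q j).1 i)
  have hlt : ∀ m i, r i = some a → ∀ j < s,
      A i * m + B i + (F.constRun r q j).1 i < N * m + ρ := by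
    intro m i hi j hj
    rcases hr i with ⟨h1, -⟩ | ⟨-, h2⟩
    · simp [h1] at hi
    · rw [Nat.add_assoc]
      exact Nat.add_lt_add_of_le_of_lt (Nat.mul_le_mul_right m (hA i)) (h2 j hj)
  have hfollow := fun m => hF.config_add_fst (r := r) (s := s)
    (fun w hw => ((hm m).1 w hw).1) (hm m).2 fun i => by
      rcases hr i with ⟨h1, h2, h3⟩ | ⟨h1, h2⟩
      · exact Or.inl ⟨h1, by rw [h2, h3]⟩
      · exact Or.inr ⟨h1, hlt m i h1⟩
  let l : (∀ (_ : Fin k) (_ : Fin s), Option α) → ℕ → Fin k → Option α := fun f j i =>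
    if h : j < s then f i ⟨j, h⟩ else none
  refine ⟨fun m => τ m + s,
    fun w c t => F.stateRun (φ w c t) (l fun i j => ψ i j w c (t - ρ)) s, ?_, fun m =>
    ⟨fun w hw => ⟨fun i => ?_, fun t ht => ?_, ?_⟩, (hfollow m).2⟩⟩
  · exact hφ.map₂ (IsCAField.pi fun i => IsCAField.pi fun j => (hψ i j).delay ρ)
      fun p f => F.stateRun p (l f) s
  · rw [(hfollow m).1 s le_rfl w hw]
    ring
  · by_cases hτ : t < τ m
    · exact ((hm m).1 w hw).2.1 t hτ
    · obtain ⟨j, rfl⟩ := Nat.exists_eq_add_of_le (not_lt.1 hτ)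
      intro hend
      dsimp only at ht
      have h1 := hend i₀
      rw [(hfollow m).1 j (by omega) w hw, hw] at h1
      exact (hlt m i₀ hi₀ j (by omega)).ne h1
  · dsimp only
    rw [config_add_snd, ((hm m).1 w hw).2.2]
    refine stateRun_congr fun j hj => funext fun i => ?_
    simp only [l, dif_pos hj, Nat.add_sub_cancel]
    rw [(hfollow m).1 j hj.le w hw]
    have := hψl i ⟨j, hj⟩ w (by rintro rfl; simp at hw; omega) m 0 (N * m) (by omega) (by omega)
    rw [Nat.cast_zero] at this
    rw [this, tape_natCast]
    congr 1
    simp only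
    ring

/-- A cycle repeated until some of the heads are close to the end-marker. -/
theorem Reaches.jump [Finite α] (hF : F.IsOblivious) (h : F.Reaches a N ρ A B q) (hN : 2 ≤ N)
    (hρ : 1 ≤ ρ) (hA : ∀ i, A i ≤ N)
    (hr : ∀ i, (r i = none ∧ A i = N ∧ B i = ρ) ∨ (r i = some a ∧ B i < ρ))
    {p : ℕ} (hq : (F.constRun r q p).2 = q) {d : Fin k → ℕ} (hd : (F.constRun r q p).1 = d)
    {i₀ : Fin k} (hi₀ : r i₀ = some a) {d₀ e : ℕ} (hd₀ : 0 < d₀)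
    (hmin : ∀ i, A i * d₀ + d i * e ≤ N * d₀) (b : ℕ) :
    F.Reaches a (N * d₀) (N * b + ρ) (fun i => A i * d₀ + d i * e) (fun i => A i * b + B i) q := by
  have := F.finite_state
  obtain ⟨τ, φ, hφ, hm⟩ := h
  have hN' : 2 ≤ N * d₀ := hN.trans (Nat.le_mul_of_pos_right N hd₀)
  -- The cell `c` handles the `c`-th block of `e` cycles, which moves the head `i` by `d i * e`;
  -- `hmin` is the condition `A + D ≤ N` for the modulus `N * d₀`.
  choose ψ hψ hψl using fun (i : Fin k) (j : Fin (p * e)) =>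
    exists_letter_field (α := α) hN' (hmin i) (A i * b + B i + (F.constRun r q j).1 i)
  let l : (∀ (_ : Fin k) (_ : Fin (p * e)), Option α) → ℕ → Fin k → Option α := fun f j i =>
    if h : j < p * e then f i ⟨j, h⟩ else none
  obtain ⟨χ, hχ, hχc⟩ := exists_composition_field (α := α) (Q := F.State) hN'
    (γ := fun w c t x => F.stateRun x (l fun i j => ψ i j w c t) (p * e))
    ((IsCAField.pi fun i => IsCAField.pi fun j => hψ i j).comp
      fun f x => F.stateRun x (l f) (p * e))
  have hrun : ∀ c j i, (F.constRun r q (p * e * c + j)).1 i =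
      e * c * d i + (F.constRun r q j).1 i := by
    intro c j i
    rw [constRun_add, Nat.mul_assoc, constRun_mul hq, hd]
  have hlen : ∀ m, N * d₀ * m + (N * b + ρ) = N * (d₀ * m + b) + ρ := fun m => by ring
  have hlt : ∀ m i, r i = some a → ∀ j ≤ p * e * m,
      A i * (d₀ * m + b) + B i + (F.constRun r q j).1 i < N * (d₀ * m + b) + ρ := by
    intro m i hi j hj
    rcases hr i with ⟨h1, -⟩ | ⟨-, h2⟩
    · simp [h1] at hi
    · have h3 := constRun_fst_mono (F := F) (r := r) (q := q) i hj
      have h4 := hrun m 0 i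
      simp only [Nat.add_zero, constRun] at h3 h4
      have h5 := Nat.mul_le_mul_right m (hmin i)
      have h6 := Nat.mul_le_mul_right b (hA i)
      nlinarith
  have hfollow := fun m => hF.config_add_fst (r := r) (s := p * e * m)
    (fun w hw => ((hm (d₀ * m + b)).1 w hw).1) (hm (d₀ * m + b)).2 fun i => by
      rcases hr i with ⟨h1, h2, h3⟩ | ⟨h1, h2⟩
      · exact Or.inl ⟨h1, by rw [h2, h3]⟩
      · exact Or.inr ⟨h1, fun j hj => hlt m i h1 j hj.le⟩
  -- The map `χ` of this phase is computed independently of the state `φ` left by the previous ones.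
  refine ⟨fun m => τ (d₀ * m + b) + p * e * m,
    fun w c t => χ w c (t - (N * b + ρ)) (φ w c t), ?_, fun m => ?_⟩
  · exact (hχ.delay _).map₂ hφ fun f x => f x
  rw [hlen]
  refine ⟨fun w hw => ⟨fun i => ?_, fun t ht => ?_, ?_⟩, ?_⟩
  · rw [(hfollow m).1 _ le_rfl w hw, ← Nat.add_zero (p * e * m), hrun]
    simp only [constRun]
    ring
  · by_cases hτ : t < τ (d₀ * m + b)
    · exact ((hm _).1 w hw).2.1 t hτ
    · obtain ⟨j, rfl⟩ := Nat.exists_eq_add_of_le (not_lt.1 hτ)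
      intro hend
      dsimp only at ht
      have h1 := hend i₀
      rw [(hfollow m).1 j (by omega) w hw, hw] at h1
      exact (hlt m i₀ hi₀ j (by omega)).ne h1
  · have h1 := hχc w m (fun c => (F.config w (τ (d₀ * m + b) + p * e * c)).2) ?_
    · dsimp only
      rw [((hm _).1 w hw).2.2, ← hlen, Nat.add_sub_cancel]
      exact h1
    · intro c t hc ht
      rw [Nat.mul_succ, ← Nat.add_assoc, config_add_snd w (τ (d₀ * m + b) + p * e * c)]
      refine stateRun_congr fun j hj => funext fun i => ?_
      have hj' : p * e * c + j ≤ p * e * m := by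
        have := Nat.mul_le_mul_left (p * e) (show c + 1 ≤ m by omega)
        rw [Nat.mul_succ] at this
        omega
      simp only [l, dif_pos hj]
      rw [Nat.add_assoc, (hfollow m).1 _ hj' w hw, hrun]
      rw [hψl i ⟨j, hj⟩ w (by rintro rfl; simp at hw; omega) m c t hc.le ht, tape_natCast]
      congr 1
      simp only
      ring
  · rw [(hfollow m).2, Nat.mul_assoc, constRun_mul hq]

/-- Only the length `ρ` is missing; at time `ρ` a finite table on a bounded window settles it. -/
theorem Decided.of_add [Finite α] (hN : 0 < N) (h : F.Decided N (N + ρ)) : F.Decided N ρ := by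
  classical
  obtain ⟨φ, hφ, hm⟩ := h
  let ι : (ℤ → Option α) → Prop := fun x =>
    ∃ w ∈ F.language, w.length = ρ ∧ ∀ j < ρ, x (j : ℕ) = w[j]?
  have hι : IsLocal ρ ι := by
    intro x y hxy
    have h : ∀ j < ρ, x (j : ℕ) = y (j : ℕ) := fun j hj => hxy j (by rw [abs_le]; omega)
    simp +contextual only [ι, h]
  have hword : ∀ w : List α, w.length = ρ → (slide ι (tape w) 0 ↔ w ∈ F.language) := by
    rintro w rfl
    simp only [slide, ι, zero_add, tape_natCast]
    constructor
    · rintro ⟨w', hw', hlen, hj⟩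
      have : w = w' := List.ext_getElem? fun j => by
        by_cases h : j < w.length
        · exact hj j h
        · rw [List.getElem?_eq_none (by omega), List.getElem?_eq_none (by omega)]
      rwa [this]
    · exact fun hw => ⟨w, hw, rfl, fun _ _ => rfl⟩
  refine ⟨fun w c t => (t = ρ ∧ slide ι (tape w) c) ∨ (t ≠ ρ ∧ φ w c t), ?_, fun m w hw => ?_⟩
  · exact ((IsCAField.time_eq ρ).prod ((IsCAField.of_isLocal hι).prod hφ)).comp
      fun p => (p.1 ∧ p.2.1) ∨ (¬p.1 ∧ p.2.2)
  · rcases m with _ | m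
    · rw [Nat.mul_zero, Nat.zero_add] at hw ⊢
      simp only [hword w hw, true_and, ne_eq, not_true_eq_false, false_and, or_false]
    · have hlen : N * (m + 1) + ρ = N * m + (N + ρ) := by ring
      have hne : N * (m + 1) + ρ ≠ ρ := by
        have := Nat.mul_pos hN m.succ_pos
        omega
      simp only [hne, false_and, ne_eq, not_false_eq_true, true_and, false_or]
      rw [hlen] at hw ⊢
      exact hm m w hw

theorem Decided.of_mul_add [Finite α] (hN : 0 < N) (s : ℕ) (h : F.Decided N (N * s + ρ)) :
    F.Decided N ρ := by
  induction s with
  | zero => simpa using h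
  | succ s ih =>
    refine ih (Decided.of_add hN ?_)
    rwa [Nat.mul_succ, Nat.add_right_comm, Nat.add_comm] at h

/-- The answer is read at the time given by the length, so a clock modulo `N * d` selects the right
one of the `d` fields run side by side. -/
theorem Decided.split {d : ℕ} (hN : 0 < N) (hd : 0 < d)
    (h : ∀ b, F.Decided (N * d) (N * b + ρ)) : F.Decided N ρ := by
  choose φ hφ hm using fun b : Fin d => h b
  refine ⟨fun w c t => ∃ b : Fin d, ((N * d : ℕ) : ℤ) ∣ t - (N * b + ρ : ℕ) ∧ φ b w c t, ?_,
    fun m w hw => ?_⟩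
  · refine (IsCAField.pi fun b : Fin d => (IsCAField.of_periodic (P := N * d)
      (g := fun t => ((N * d : ℕ) : ℤ) ∣ t - (N * b + ρ : ℕ)) (Nat.mul_pos hN hd) ?_).map₂
        (hφ b) And).comp fun f => ∃ b, f b
    intro t
    simp only
    rw [Nat.cast_add, add_sub_right_comm, dvd_add_self_right]
  · have hmd : N * m + ρ = N * d * (m / d) + (N * (m % d) + ρ) := by
      conv_lhs => rw [← Nat.div_add_mod m d]
      ring
    have hlt := Nat.mod_lt m hd
    have hb := hm ⟨m % d, hlt⟩ (m / d) w (by rw [hw, hmd])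
    rw [← hb, ← hmd]
    constructor
    · rintro ⟨b, ⟨z, hz⟩, hφb⟩
      have hz' : ((N * d : ℕ) : ℤ) ∣ (N : ℤ) * ((m : ℤ) - b) :=
        ⟨z, by rw [← hz]; push_cast; ring⟩
      rw [Nat.cast_mul, mul_dvd_mul_iff_left (by omega)] at hz'
      have hbm : m ≡ b [MOD d] := (Nat.modEq_iff_dvd.2 hz').symm
      have : (⟨m % d, hlt⟩ : Fin d) = b := Fin.ext (Eq.trans hbm (Nat.mod_eq_of_lt b.2))
      rwa [this]
    · intro hφb
      exact ⟨⟨m % d, hlt⟩, ⟨(m / d : ℕ), by rw [hmd]; push_cast; ring⟩, hφb⟩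

end OneWayMultiheadDFA

/-! ### Induction on the phases and conclusion. -/

namespace OneWayMultiheadDFA

variable {α : Type u} {k : ℕ} {F : OneWayMultiheadDFA.{u, v} α k}

/-- Lexicographic induction on the number `x` of far heads (`A i < N`) and the total distance `y` of
the near heads (`A i = N`) to the end. The state `q` on the constant word does not depend on `m`, so
the next phase is the same for the whole progression. -/
theorem Reaches.decided [Finite α] (hF : F.IsOblivious) (a : α) : ∀ (x y N ρ : ℕ)
    (A B : Fin k → ℕ) (q : F.State), 2 ≤ N → 1 ≤ ρ → (∀ i, A i ≤ N) → (∀ i, B i ≤ ρ) →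
    (Finset.univ.filter fun i => A i < N).card = x →
    (∑ i, if A i = N then ρ - B i else 0) = y → F.Reaches a N ρ A B q → F.Decided N ρ := by
  intro x
  induction x using Nat.strong_induction_on with
  | _ x ihx =>
  intro y
  induction y using Nat.strong_induction_on with
  | _ y ihy =>
  intro N ρ A B q hN hρ hA hB hx hy hreach
  classical
  by_cases hend : ∀ i, A i = N ∧ B i = ρ
  · exact hreach.decided_of_atEnd (fun i => (hend i).1) fun i => (hend i).2
  obtain ⟨i₀, hi₀⟩ := not_forall.1 hend
  let r : Fin k → Option α := fun i => if A i = N ∧ B i = ρ then none else some a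
  have hr₀ : r i₀ = some a := if_neg hi₀
  have hrn : ∀ i, A i = N ∧ B i = ρ → r i = none := fun i hi => if_pos hi
  have hrs : ∀ i, ¬(A i = N ∧ B i = ρ) → r i = some a := fun i hi => if_neg hi
  clear_value r
  have := F.finite_state
  obtain ⟨p, p', hpp', hpq⟩ : ∃ p p', p < p' ∧
      (F.constRun r q p).2 = (F.constRun r q p').2 := by
    obtain ⟨p, p', hne, heq⟩ :=
      Finite.exists_ne_map_eq_of_infinite fun s => (F.constRun r q s).2
    rcases lt_or_gt_of_ne hne with h | h
    · exact ⟨p, p', h, heq⟩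
    · exact ⟨p', p, h, heq.symm⟩
  -- After this shift the heads far from the end-marker do not meet it during the first `p'` steps.
  have hshift := hreach.shift p'
  refine Decided.of_mul_add (by omega) p' ?_
  have hρ' : 1 ≤ N * p' + ρ := by omega
  have hfar : ∀ i, A i ≠ N → A i * p' + B i + p' ≤ N * p' + ρ := by
    intro i hi
    have h1 : A i + 1 ≤ N := lt_of_le_of_ne (hA i) hi
    have h2 := Nat.mul_le_mul_right p' h1
    have h3 := hB i
    rw [Nat.add_mul, Nat.one_mul] at h2
    omega
  -- If a near head moves, the phase is stopped at the first such move, as the end-marker may then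
  -- be reached; near heads have moved by at most one and `y` drops. Otherwise only far heads move
  -- along the cycle.
  by_cases hmove : ∃ s, s ≤ p' ∧ ∃ i, A i = N ∧ 0 < (F.constRun r q s).1 i
  · obtain ⟨s, ⟨hs, i₁, hi₁, hpos⟩, hleast⟩ :
        ∃ s, (s ≤ p' ∧ ∃ i, A i = N ∧ 0 < (F.constRun r q s).1 i) ∧
          ∀ j < s, ∀ i, A i = N → (F.constRun r q j).1 i = 0 := by
      refine ⟨Nat.find hmove, Nat.find_spec hmove, fun j hj i hi => ?_⟩
      have h1 := Nat.find_min hmove hj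
      have h2 := (Nat.find_spec hmove).1
      by_contra h3
      exact h1 ⟨by omega, i, hi, by omega⟩
    obtain ⟨s, rfl⟩ : ∃ s', s = s' + 1 := by
      refine ⟨s - 1, ?_⟩
      rcases s with _ | s
      · simp [constRun] at hpos
      · rfl
    have hone : ∀ i, A i = N → (F.constRun r q (s + 1)).1 i ≤ 1 := by
      intro i hi
      have h1 := constRun_fst_succ_le (F := F) (r := r) (q := q) s i
      rw [hleast s (by omega) i hi] at h1
      omega
    have hlt : ∀ i, A i = N → 0 < (F.constRun r q (s + 1)).1 i → B i < ρ := by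
      intro i hi h1
      refine lt_of_le_of_ne (hB i) fun h2 => ?_
      rw [constRun_fst_eq_zero (hrn i ⟨hi, h2⟩)] at h1
      omega
    have hrun := hshift.run hF hN hρ' hA (s + 1) (r := r) (fun i => by
      by_cases hi : A i = N ∧ B i = ρ
      · exact Or.inl ⟨hrn i hi, hi.1, by rw [hi.1, hi.2]⟩
      · refine Or.inr ⟨hrs i hi, fun j hj => ?_⟩
        by_cases hiN : A i = N
        · have := lt_of_le_of_ne (hB i) fun h => hi ⟨hiN, h⟩
          rw [hleast j hj i hiN, hiN]
          omega
        · have h1 := constRun_fst_le (F := F) (r := r) (q := q) j i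
          have h2 := hfar i hiN
          omega) hr₀
    refine ihy _ ?_ N (N * p' + ρ) A _ _ hN hρ' hA ?_ hx rfl hrun
    · rw [← hy]
      refine Finset.sum_lt_sum (fun i _ => ?_) ⟨i₁, Finset.mem_univ _, ?_⟩
      · split_ifs with hi
        · rw [hi]; omega
        · exact le_rfl
      · have := hlt i₁ hi₁ hpos
        rw [if_pos hi₁, if_pos hi₁, hi₁]
        omega
    · intro i
      by_cases hi : A i = N
      · have h1 := hone i hi
        have h2 := hlt i hi
        have h3 := hB i
        rw [hi]
        omega
      · have h1 := constRun_fst_le (F := F) (r := r) (q := q) (s + 1) i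
        have h2 := hfar i hi
        omega
  · have hstay : ∀ j ≤ p', ∀ i, A i = N → (F.constRun r q j).1 i = 0 := by
      intro j hj i hi
      by_contra h
      exact hmove ⟨j, hj, i, hi, by omega⟩
    have hcond : ∀ i, (r i = none ∧ A i = N ∧ A i * p' + B i = N * p' + ρ) ∨
        (r i = some a ∧ ∀ j < p', A i * p' + B i + (F.constRun r q j).1 i < N * p' + ρ) := by
      intro i
      by_cases hi : A i = N ∧ B i = ρ
      · exact Or.inl ⟨hrn i hi, hi.1, by rw [hi.1, hi.2]⟩
      · refine Or.inr ⟨hrs i hi, fun j hj => ?_⟩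
        by_cases hiN : A i = N
        · have := lt_of_le_of_ne (hB i) fun h => hi ⟨hiN, h⟩
          rw [hstay j hj.le i hiN, hiN]
          omega
        · have h1 := constRun_fst_le (F := F) (r := r) (q := q) j i
          have h2 := hfar i hiN
          omega
    have hrun := hshift.run hF hN hρ' hA p (r := r) (fun i => (hcond i).imp_right fun h =>
      ⟨h.1, fun j hj => h.2 j (by omega)⟩) hr₀
    set q' := (F.constRun r q p).2 with hq'
    obtain ⟨l, rfl⟩ := Nat.exists_eq_add_of_lt hpp'
    rw [Nat.add_assoc] at *
    have hcycle : (F.constRun r q' (l + 1)).2 = q' := by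
      rw [constRun_add, ← hq'] at hpq
      exact hpq.symm
    have hcond' : ∀ i, (r i = none ∧ A i = N ∧
          A i * (p + (l + 1)) + B i + (F.constRun r q p).1 i = N * (p + (l + 1)) + ρ) ∨
        (r i = some a ∧
          A i * (p + (l + 1)) + B i + (F.constRun r q p).1 i < N * (p + (l + 1)) + ρ) := by
      intro i
      rcases hcond i with ⟨h1, h2, h3⟩ | ⟨h1, h2⟩
      · exact Or.inl ⟨h1, h2, by rw [constRun_fst_eq_zero h1]; exact h3⟩
      · exact Or.inr ⟨h1, h2 p hpp'⟩
    let d := (F.constRun r q' (l + 1)).1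
    have hdN : ∀ i, A i = N → d i = 0 := by
      intro i hi
      have h1 := hstay _ le_rfl i hi
      rw [constRun_add] at h1
      change _ + d i = 0 at h1
      omega
    by_cases hd : ∀ i, d i = 0
    · exact hrun.decided_of_loop hF hA hcond' l.succ_pos hcycle hd hr₀
    obtain ⟨i₂, hi₂⟩ := not_forall.1 hd
    -- Up to bounded terms, the head `i` needs `(N - A i) m / d i` cycles to reach the end, so `i₁`
    -- is a first one to get near it. With `d₀ = d i₁` and `e = N - A i₁` its new slope is the new
    -- modulus `N * d i₁`, and minimality keeps the other slopes below it; thus `x` drops.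
    obtain ⟨i₁, hi₁, hmin⟩ := (Finset.univ.filter fun i => 0 < d i).exists_min_image
      (fun i => ((N - A i : ℕ) : ℚ) / d i) ⟨i₂, by simp; omega⟩
    have hd₁ : 0 < d i₁ := (Finset.mem_filter.1 hi₁).2
    have hA₁ : A i₁ < N := lt_of_le_of_ne (hA i₁) fun h => by rw [hdN i₁ h] at hd₁; omega
    have hle : ∀ i, A i * d i₁ + d i * (N - A i₁) ≤ N * d i₁ := by
      intro i
      have h1 : d i * (N - A i₁) ≤ (N - A i) * d i₁ := by
        rcases Nat.eq_zero_or_pos (d i) with h | h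
        · rw [h, Nat.zero_mul]; exact Nat.zero_le _
        · have h2 := hmin i (by simp [h])
          rw [div_le_div_iff₀ (by exact_mod_cast hd₁) (by exact_mod_cast h)] at h2
          rw [Nat.mul_comm]
          exact_mod_cast h2
      have h3 : (N - A i) * d i₁ + A i * d i₁ = N * d i₁ := by
        rw [← Nat.add_mul, Nat.sub_add_cancel (hA i)]
      omega
    refine Decided.split (d := d i₁) (by omega) hd₁ fun b => ?_
    have hjump := hrun.jump hF hN hρ' hA hcond' hcycle (d := d) rfl hr₀ hd₁ hle b
    refine ihx _ ?_ _ _ _ _ _ _ (hN.trans (Nat.le_mul_of_pos_right N hd₁)) (by omega) hle ?_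
      rfl rfl hjump
    · rw [← hx]
      refine Finset.card_lt_card (Finset.ssubset_iff_of_subset ?_ |>.2 ⟨i₁, ?_, ?_⟩)
      · intro i hi
        rw [Finset.mem_filter] at hi ⊢
        refine ⟨hi.1, lt_of_le_of_ne (hA i) fun h => ?_⟩
        rw [h, hdN i h] at hi
        omega
      · simpa using hA₁
      · rw [Finset.mem_filter, Nat.mul_comm (d i₁), ← Nat.add_mul,
          Nat.add_sub_cancel' hA₁.le]
        simp
    · intro i
      have h1 := Nat.mul_le_mul_right b (hA i)
      rcases hcond' i with ⟨-, -, h2⟩ | ⟨-, h2⟩ <;> omega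

theorem Reaches.start (F : OneWayMultiheadDFA.{u, v} α k) (a : α) (N ρ : ℕ) :
    F.Reaches a N ρ (fun _ => 0) (fun _ => 0) F.start := by
  refine ⟨fun _ => 0, fun _ _ _ => F.start, IsCAField.const _, fun m =>
    ⟨fun w _ => ⟨fun i => ?_, by simp, rfl⟩, rfl⟩⟩
  simp [config]

theorem IsOblivious.exists_field [Finite α] (hF : F.IsOblivious) :
    ∃ φ : List α → ℤ → ℕ → Prop, IsCAField φ ∧
      ∀ w, w ≠ [] → (φ w 0 w.length ↔ w ∈ F.language) := by
  rcases isEmpty_or_nonempty α with hα | ⟨⟨a⟩⟩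
  · refine ⟨fun _ _ _ => False, IsCAField.const False, fun w hw => ?_⟩
    exact absurd (List.eq_nil_iff_forall_not_mem.2 fun x => hα.elim x) hw
  -- The diagonals require a modulus at least `2`, hence the splitting by parity; `ρ = 1` leaves out
  -- only the empty word.
  · have hdec : F.Decided 1 1 := Decided.split (d := 2) (by omega) (by omega) fun b =>
      Reaches.decided hF a _ _ _ _ _ _ _ (by omega) (by omega) (by simp) (by simp) rfl rfl
        (Reaches.start F a _ _)
    obtain ⟨φ, hφ, hm⟩ := hdec
    refine ⟨φ, hφ, fun w hw => ?_⟩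
    have hlen : w.length = 1 * (w.length - 1) + 1 := by
      have := List.length_pos_iff.2 hw
      omega
    have := hm (w.length - 1) w hlen
    rwa [← hlen] at this

end OneWayMultiheadDFA

theorem theorem4p1 {α : Type u} [Finite α] (k : ℕ) (hk : 1 ≤ k)
    (F : OneWayMultiheadDFA.{u, v} α k) (hF : F.IsOblivious)
    (L : Language α) (hL : F.language = L) :
    ∃ C : CellularAutomaton α, C.realTimeLanguage = L := by
  subst hL
  obtain ⟨φ, hφ, hφL⟩ := hF.exists_field
  exact exists_realTimeLanguage_eq hφ hφL
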